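/- Let $\Delta$ be a finite connected flag complex (a finite simplicial complex in which every complete subgraph of the $1$-skeleton spans a simplex). A directed cycle of length $l\ge 2$ in $\Delta$ is a sequence $c=(e_1,\dots,e_l)$ of directed edges such that the terminal vertex of $e_i$ is the initial vertex of $e_{i+1}$ for $i<l$ and the terminal vertex of $e_l$ is the initial vertex of $e_1$; vertices and edges may be repeated. For $n\in\mathbb Z$ let $c^{[n]}$ denote the word $e_1^n e_2^n\cdots e_l^n$ in the free group $F$ on the set of directed edges of $\Delta$. An element of $F$ is a consequence of a subset $R\subseteq F$ if it lies in the normal closure of $R$ in $F$. Consider the group presentation $\mathcal P_\Delta$ whose generators are the directed edges of $\Delta$ and whose relators are the words $c^{[n]}$ for all directed cycles $c$ (of any length $l\geq 2$) and all nonzero integers $n$. It can be simplified as follows. (a) If $c$ is a directed cycle of length $2$, then for every $n\in\mathbb Z$ the relator $c^{[n]}$ is a consequence of $c^{[1]}$. (b) If $c$ is a directed cycle of length $3$, then for every $n\in\mathbb Z$ the relator $c^{[n]}$ is a consequence of $c^{[1]}$ and $c^{[-1]}$. (c) The set $S$ consisting of the relators $c^{[1]}$ for all directed cycles $c$ of length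 $2$ and the relators $c^{[1]}$ and $c^{[-1]}$ for all directed cycles $c$ of length $3$ is finite. Let $c_1,\dots,c_m$ ($m\ge 0$) be directed cycles in $\Delta$ such that the normal subgroup of $\pi_1(\Delta)$ generated by the conjugacy classes determined by $c_1,\dots,c_m$ is the whole of $\pi_1(\Delta)$. Then for every directed cycle $d$ and every $n\in\mathbb Z$ the relator $d^{[n]}$ is a consequence of $S$ together with the relators $c_i^{[k]}$, $1\le i\le m$, $k\in\mathbb Z$. Equivalently, these relators have the same normal closure in $F$ as the set of all relators of $\mathcal P_\Delta$. -/

import Mathlib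

namespace FlagPresentation

open scoped unitInterval

/-! ### Simplicial complexes: 1-skeleton, flag condition, geometric realization -/

section Complex

variable {V : Type*} [DecidableEq V]

/-- The 1-skeleton of a simplicial complex, as a simple graph.  Its darts are the directed edges of
the complex. -/
def skeleton (K : AbstractSimplicialComplex V) : SimpleGraph V where
  Adj u v := u ≠ v ∧ ({u, v} : Finset V) ∈ K.faces
  symm := ⟨fun u v h => ⟨h.1.symm, Finset.pair_comm u v ▸ h.2⟩⟩
  loopless := ⟨fun _ h => h.1 rfl⟩

/-- A flag complex: every complete subgraph of the 1-skeleton spans a simplex. -/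
def IsFlag (K : AbstractSimplicialComplex V) : Prop :=
  ∀ s : Finset V, s.Nonempty → (skeleton K).IsClique (s : Set V) → s ∈ K.faces

variable [Fintype V]

/-- The geometric realization of a finite simplicial complex, in barycentric coordinates: the points
of the standard simplex on the vertex set whose support lies in a face.  It carries the subspace
topology from `V → ℝ`. -/
abbrev Realization (K : AbstractSimplicialComplex V) : Type _ :=
  {x : V → ℝ // x ∈ stdSimplex ℝ V ∧ ∃ s ∈ K.faces, ∀ v, x v ≠ 0 → v ∈ s}

/-- A vertex, as a point of the realization. -/
noncomputable def vertex (K : AbstractSimplicialComplex V) (v : V) : Realization K :=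
  ⟨Pi.single v 1, single_mem_stdSimplex ℝ v, {v}, K.singleton_mem v, fun w hw => by
    by_contra h
    exact hw (Pi.single_eq_of_ne (by simpa using h) _)⟩

/-- The straight path along a directed edge of the complex. -/
noncomputable def edgePath (K : AbstractSimplicialComplex V) {u v : V}
    (h : (skeleton K).Adj u v) : Path (vertex K u) (vertex K v) where
  toFun t := ⟨(1 - (t : ℝ)) • (Pi.single u 1 : V → ℝ) + (t : ℝ) • (Pi.single v 1 : V → ℝ),
    convex_stdSimplex ℝ V (single_mem_stdSimplex ℝ u) (single_mem_stdSimplex ℝ v)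
      (sub_nonneg.2 t.2.2) t.2.1 (by ring),
    {u, v}, h.2, fun w hw => by
      by_contra hn
      simp only [Finset.mem_insert, Finset.mem_singleton, not_or] at hn
      exact hw (by simp [Pi.single_eq_of_ne hn.1, Pi.single_eq_of_ne hn.2])⟩
  continuous_toFun := by fun_prop
  source' := by simp [vertex]
  target' := by simp [vertex]

/-- The path in the realization that runs through the edges of a walk in the 1-skeleton. -/
noncomputable def walkPath (K : AbstractSimplicialComplex V) :
    {u v : V} → (skeleton K).Walk u v → Path (vertex K u) (vertex K v)
  | _, _, .nil => Path.refl _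
  | _, _, .cons h p => (edgePath K h).trans (walkPath K p)

end Complex

/-! ### Free loops in the fundamental group -/

/-- The conjugacy class in `π₁(X, a)` determined by a loop `γ` at a point `b`, that is, the set of
classes of the loops `p · γ · p⁻¹` for the paths `p` from `a` to `b`. -/
def loopClass {X : Type*} [TopologicalSpace X] (a : X) {b : X} (γ : Path b b) :
    Set (FundamentalGroup X a) :=
  {g | ∃ p : Path a b,
    g = FundamentalGroup.fromPath (Path.Homotopic.Quotient.mk ((p.trans γ).trans p.symm))}

/-! ### Directed cycles and relators -/

section Relators

variable {V : Type*} [DecidableEq V]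

/-- A directed cycle `(e₁, …, e_l)`, `l ≥ 2`, in a simplicial complex: a closed walk in the
1-skeleton (repetitions are allowed), with its starting point. -/
structure DirectedCycle (K : AbstractSimplicialComplex V) where
  base : V
  walk : (skeleton K).Walk base base
  two_le : 2 ≤ walk.length

/-- The length `l` of a directed cycle. -/
def DirectedCycle.length {K : AbstractSimplicialComplex V} (c : DirectedCycle K) : ℕ :=
  c.walk.length

/-- The word `c^[n] = e₁ⁿ ⋯ e_lⁿ` in the free group on the directed edges. -/
def DirectedCycle.relator {K : AbstractSimplicialComplex V} (c : DirectedCycle K) (n : ℤ) :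
    FreeGroup (skeleton K).Dart :=
  (c.walk.darts.map fun e => FreeGroup.of e ^ n).prod

/-- The loop in the realization traced by a directed cycle. -/
noncomputable def DirectedCycle.loop [Fintype V] {K : AbstractSimplicialComplex V}
    (c : DirectedCycle K) : Path (vertex K c.base) (vertex K c.base) :=
  walkPath K c.walk

/-- All the relators `c^[n]`, for `c` a directed cycle and `n ≠ 0`. -/
def allRelators (K : AbstractSimplicialComplex V) : Set (FreeGroup (skeleton K).Dart) :=
  {r | ∃ (c : DirectedCycle K) (n : ℤ), n ≠ 0 ∧ r = c.relator n}

/-- The short relators: `c^[1]` for the cycles of length 2, and `c^[1]`, `c^[-1]` for those of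
length 3. -/
def shortRelators (K : AbstractSimplicialComplex V) : Set (FreeGroup (skeleton K).Dart) :=
  {r | ∃ c : DirectedCycle K, c.length = 2 ∧ r = c.relator 1} ∪
  {r | ∃ c : DirectedCycle K, c.length = 3 ∧ (r = c.relator 1 ∨ r = c.relator (-1))}

/-- The short relators together with the relators `c_i^[n]` (all `n`) of a given family of directed
cycles. -/
def reducedRelators (K : AbstractSimplicialComplex V) {m : ℕ} (c : Fin m → DirectedCycle K) :
    Set (FreeGroup (skeleton K).Dart) :=
  shortRelators K ∪ {r | ∃ (i : Fin m) (n : ℤ), r = (c i).relator n}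

end Relators

end FlagPresentation

/-! The powers `e ↦ eⁿ` of the directed edges define, modulo the short relators, a group-valued
cocycle on `K`: the relators of the 2-cycles say that opposite edges are inverse to each other, and
those of the 3-cycles that `e f g = 1 = e⁻¹ f⁻¹ g⁻¹` around a triangle, so that `e` and `f` commute
and `eⁿ fⁿ gⁿ = 1`.  This already gives (a) and (b).

For (c), let `G` be the quotient of the free group by the normal closure of the reduced relators.
For each `n`, the cocycle `e ↦ eⁿ` glues the open stars of the vertices times the discrete set `G`
to a covering space of the realization (`EdgeCocycle.bundleCore`).  The monodromy of this covering
along an edge walk is the right multiplication by the product of the cocycle along the walk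
(`EdgeCocycle.monodromy_walkPath`), so a directed cycle `d` has trivial monodromy exactly when
`d^[n] = 1` in `G`.  The elements of the fundamental group with trivial monodromy form a normal
subgroup.  It contains the classes of the given cycles, hence is everything, so that all directed
cycles have trivial monodromy (`monodromy_eq_of_normalClosure_loopClass_eq_top`).  No simplicial
approximation of loops or homotopies is needed. -/

namespace FlagPresentation

open scoped unitInterval

/-! ### Powers of short relations in groups -/

section Powers

variable {G : Type*} [Group G]

theorem zpow_mul_zpow_eq_one {a b : G} (h : a * b = 1) (n : ℤ) : a ^ n * b ^ n = 1 := by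
  obtain rfl := eq_inv_of_mul_eq_one_right h
  simp

theorem zpow_mul_zpow_mul_zpow_eq_one {a b c : G} (h : a * b * c = 1)
    (h' : a⁻¹ * b⁻¹ * c⁻¹ = 1) (n : ℤ) : a ^ n * b ^ n * c ^ n = 1 := by
  obtain rfl := eq_inv_of_mul_eq_one_right h
  have hab : Commute a b := by
    rw [inv_inv, ← mul_inv_rev, inv_mul_eq_one] at h'
    exact h'.symm
  rw [← hab.mul_zpow, inv_zpow, mul_inv_cancel]

end Powers

/-! ### Relators of short cycles -/

section ShortCycles

variable {V : Type*} [DecidableEq V] {K : AbstractSimplicialComplex V}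

theorem DirectedCycle.map_relator_eq_one_of_length_eq_two {G : Type*} [Group G]
    (f : FreeGroup (skeleton K).Dart →* G) {c : DirectedCycle K} (hc : c.length = 2)
    (h : f (c.relator 1) = 1) (n : ℤ) : f (c.relator n) = 1 := by
  obtain ⟨d, e, hd⟩ := List.length_eq_two.1 (c.walk.length_darts.trans hc)
  simp only [relator, hd, List.map_cons, List.map_nil, List.prod_cons, List.prod_nil, mul_one,
    map_mul, map_zpow, zpow_one] at h ⊢
  exact zpow_mul_zpow_eq_one h n

theorem DirectedCycle.map_relator_eq_one_of_length_eq_three {G : Type*} [Group G]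
    (f : FreeGroup (skeleton K).Dart →* G) {c : DirectedCycle K} (hc : c.length = 3)
    (h : f (c.relator 1) = 1) (h' : f (c.relator (-1)) = 1) (n : ℤ) : f (c.relator n) = 1 := by
  obtain ⟨d, e, g, hd⟩ := List.length_eq_three.1 (c.walk.length_darts.trans hc)
  simp only [relator, hd, List.map_cons, List.map_nil, List.prod_cons, List.prod_nil, mul_one,
    map_mul, map_inv, map_zpow, zpow_one, zpow_neg, ← mul_assoc] at h h' ⊢
  exact zpow_mul_zpow_mul_zpow_eq_one h h' n

theorem finite_shortRelators [Fintype V] (K : AbstractSimplicialComplex V) :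
    (shortRelators K).Finite := by
  classical
  have : Finite (skeleton K).Dart :=
    Finite.of_injective (fun d : (skeleton K).Dart => d.toProd) fun _ _ h =>
      SimpleGraph.Dart.ext _ _ h
  refine (((List.finite_length_le (skeleton K).Dart 3).prod (Set.toFinite {(1 : ℤ), -1})).image
    fun p => (p.1.map fun e => FreeGroup.of e ^ p.2).prod).subset ?_
  rintro r (⟨c, hc, rfl⟩ | ⟨c, hc, rfl | rfl⟩)
  · exact ⟨(c.walk.darts, 1), ⟨by simpa using! hc.le.trans (by norm_num), by simp⟩, rfl⟩
  · exact ⟨(c.walk.darts, 1), ⟨by simpa using! hc.le, by simp⟩, rfl⟩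
  · exact ⟨(c.walk.darts, -1), ⟨by simpa using! hc.le, by simp⟩, rfl⟩

end ShortCycles

/-! ### Supports of points of the realization -/

section Support

variable {V : Type*} [Fintype V] {K : AbstractSimplicialComplex V}

theorem exists_apply_ne_zero (x : Realization K) : ∃ v, x.1 v ≠ 0 := by
  by_contra! h
  simpa [h] using x.2.1.2

theorem mem_faces_of_apply_ne_zero (x : Realization K) {s : Finset V} (hs : s.Nonempty)
    (h : ∀ v ∈ s, x.1 v ≠ 0) : s ∈ K.faces := by
  obtain ⟨t, ht, hxt⟩ := x.2.2
  exact (K.isRelLowerSet_faces ht).2 (fun v hv => hxt v (h v hv)) hs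

end Support

/-! ### Cocycles on the edges of a complex -/

/-- A 1-cocycle on a simplicial complex with values in a group: a function `ψ` on pairs of vertices
with `ψ u u = 1` that is multiplicative on the faces of dimension at most 2.  The values on pairs
that do not span a face are arbitrary. -/
structure EdgeCocycle {V : Type*} [DecidableEq V] (K : AbstractSimplicialComplex V)
    (G : Type*) [Group G] where
  toFun : V → V → G
  map_self : ∀ u, toFun u u = 1
  map_mul : ∀ u v w, ({u, v, w} : Finset V) ∈ K.faces → toFun u v * toFun v w = toFun u w

namespace EdgeCocycle

variable {V : Type*} [DecidableEq V] {K : AbstractSimplicialComplex V} {G : Type*} [Group G]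

/-- A homomorphism that kills the short relators turns the `n`-th powers of the directed edges into
a cocycle, extended by `1` to the pairs of vertices that are not edges. -/
noncomputable def ofHom (f : FreeGroup (skeleton K).Dart →* G)
    (hf : ∀ r ∈ shortRelators K, f r = 1) (n : ℤ) : EdgeCocycle K G where
  toFun u v := open Classical in
    if h : (skeleton K).Adj u v then f (FreeGroup.of ⟨(u, v), h⟩) ^ n else 1
  map_self u := by simp
  map_mul u v w hface := by
    have edge {x y : V} (hxy : x ≠ y) (hx : x ∈ ({u, v, w} : Finset V))
        (hy : y ∈ ({u, v, w} : Finset V)) : (skeleton K).Adj x y :=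
      ⟨hxy, (K.isRelLowerSet_faces hface).2
        (Finset.insert_subset hx (Finset.singleton_subset_iff.2 hy)) ⟨x, by simp⟩⟩
    -- Opposite directed edges have inverse powers.
    have back {x y : V} (h : (skeleton K).Adj x y) :
        f (FreeGroup.of ⟨(x, y), h⟩) ^ n * f (FreeGroup.of ⟨(y, x), h.symm⟩) ^ n = 1 := by
      have := DirectedCycle.map_relator_eq_one_of_length_eq_two f
        (c := ⟨x, .cons h (.cons h.symm .nil), le_rfl⟩) rfl (hf _ (.inl ⟨_, rfl, rfl⟩)) n
      simpa [DirectedCycle.relator] using this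
    rcases eq_or_ne u v with rfl | huv
    · simp
    rcases eq_or_ne v w with rfl | hvw
    · simp
    have auv := edge huv (by simp) (by simp)
    have avw := edge hvw (by simp) (by simp)
    rcases eq_or_ne u w with rfl | huw
    · rw [dif_pos auv, dif_pos avw, dif_neg (SimpleGraph.irrefl _)]
      exact back auv
    have auw := edge huw (by simp) (by simp)
    rw [dif_pos auv, dif_pos avw, dif_pos auw]
    let c : DirectedCycle K :=
      ⟨u, .cons auv (.cons avw (.cons auw.symm .nil)), by simp⟩
    have h3 := c.map_relator_eq_one_of_length_eq_three f rfl
      (hf _ (.inr ⟨c, rfl, .inl rfl⟩)) (hf _ (.inr ⟨c, rfl, .inr rfl⟩)) n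
    simp only [DirectedCycle.relator, c, SimpleGraph.Walk.darts_cons, SimpleGraph.Walk.darts_nil,
      List.map_cons, List.map_nil, List.prod_cons, List.prod_nil, mul_one, _root_.map_mul,
      map_zpow, ← mul_assoc] at h3
    -- Both `u v` followed by `v w` and `u w` are inverse to `w u`.
    exact mul_right_cancel (h3.trans (back auw).symm)

theorem prod_darts_ofHom (f : FreeGroup (skeleton K).Dart →* G)
    (hf : ∀ r ∈ shortRelators K, f r = 1) (n : ℤ) (c : DirectedCycle K) :
    (c.walk.darts.map fun e => (ofHom f hf n).toFun e.fst e.snd).prod = f (c.relator n) := by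
  rw [DirectedCycle.relator, map_list_prod, List.map_map]
  congr 1
  refine List.map_congr_left fun e _ => ?_
  simp only [ofHom, dif_pos e.adj, Function.comp_apply, map_zpow]

/-! ### The covering space of a cocycle -/

variable [Fintype V] [TopologicalSpace G] [DiscreteTopology G] (ψ : EdgeCocycle K G)

/-- The covering space of the realization determined by a cocycle: over the open star of each vertex
it is the product with the discrete group `G`, and over the intersection of the stars of `u` and `v`
the two products are identified by the right multiplication by `ψ u v`. -/
noncomputable def bundleCore : FiberBundleCore V (Realization K) G where
  baseSet v := {x | x.1 v ≠ 0}
  isOpen_baseSet v := isOpen_ne_fun ((continuous_apply v).comp continuous_subtype_val) continuous_const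
  indexAt x := (exists_apply_ne_zero x).choose
  mem_baseSet_at x := (exists_apply_ne_zero x).choose_spec
  coordChange u v _ g := g * ψ.toFun u v
  coordChange_self u x _ g := by rw [ψ.map_self, mul_one]
  continuousOn_coordChange u v := (continuous_mul_const _ |>.comp continuous_snd).continuousOn
  coordChange_comp u v w x hx g := by
    rw [mul_assoc, ψ.map_mul u v w (mem_faces_of_apply_ne_zero x (by simp) ?_)]
    simpa using ⟨hx.1.1, hx.1.2, hx.2⟩

theorem isCoveringMap_proj : IsCoveringMap ψ.bundleCore.proj :=
  FiberBundle.isCoveringMap (F := G) (E := ψ.bundleCore.Fiber)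

/-- A vertex lies in no other open star than its own. -/
theorem indexAt_vertex (v : V) : ψ.bundleCore.indexAt (vertex K v) = v := by
  by_contra h
  exact ψ.bundleCore.mem_baseSet_at (vertex K v) (Pi.single_eq_of_ne h _)

/-- The point with coordinate `g` in the fibre over a vertex. -/
noncomputable def fiberPoint (v : V) (g : G) : ψ.bundleCore.proj ⁻¹' {vertex K v} :=
  ⟨⟨vertex K v, g⟩, rfl⟩

theorem fiberPoint_injective (v : V) : Function.Injective (ψ.fiberPoint v) := by
  intro g h hgh
  exact Bundle.TotalSpace.mk_injective (F := G) (E := ψ.bundleCore.Fiber) (vertex K v)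
    (congrArg Subtype.val hgh)

theorem exists_eq_fiberPoint {v : V} (e : ψ.bundleCore.proj ⁻¹' {vertex K v}) :
    ∃ g, e = ψ.fiberPoint v g := by
  obtain ⟨⟨x, g⟩, hx⟩ := e
  obtain rfl : x = vertex K v := hx
  exact ⟨g, rfl⟩

end EdgeCocycle

/-! ### Monodromy -/

section Monodromy

variable {E X : Type*} [TopologicalSpace E] [TopologicalSpace X] {p : E → X}

theorem monodromy_mk_eq_of_lift (cov : IsCoveringMap p) {x y : X} (γ : Path x y) (e : p ⁻¹' {x})
    (e' : p ⁻¹' {y}) {Γ : I → E} (hΓ : Continuous Γ) (hp : p ∘ Γ = γ) (h0 : Γ 0 = e)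
    (h1 : Γ 1 = e') : cov.monodromy (.mk γ) e = e' := by
  apply Subtype.ext
  have := (cov.eq_liftPath_iff (γ := γ) (γ_0 := γ.source.trans e.2.symm) (Γ := Γ)).2 ⟨hΓ, hp, h0⟩
  rw [← h1, this]
  rfl

/-- If loops with trivial monodromy normally generate the fundamental group, then all loops that
can be joined to the base point have trivial monodromy. -/
theorem monodromy_eq_of_normalClosure_loopClass_eq_top (cov : IsCoveringMap p) {a : X}
    {ι : Type*} {b : ι → X} (γ : ∀ i, Path (b i) (b i))
    (hγ : Subgroup.normalClosure (⋃ i, loopClass a (γ i)) = ⊤)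
    (htriv : ∀ i e, cov.monodromy (.mk (γ i)) e = e) {y : X} (q : Path a y) (δ : Path y y)
    (e : p ⁻¹' {y}) : cov.monodromy (.mk δ) e = e := by
  -- Transport along a path and back is the identity.
  have back {x z : X} (r : Path x z) (e : p ⁻¹' {x}) :
      cov.monodromy (.mk r.symm) (cov.monodromy (.mk r) e) = e := by
    rw [← cov.monodromy_trans_apply, ← Path.Homotopic.Quotient.mk_trans,
      Path.Homotopic.Quotient.eq.2 ⟨(Path.Homotopy.reflTransSymm r).symm⟩,
      Path.Homotopic.Quotient.mk_refl, cov.monodromy_refl, id]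
  have hker : (cov.monodromyPerm a).ker = ⊤ := by
    refine top_le_iff.1 (hγ ▸ Subgroup.normalClosure_le_normal ?_)
    refine Set.iUnion_subset fun i => ?_
    rintro _ ⟨r, rfl⟩
    refine Equiv.ext fun e => ?_
    change cov.monodromy (.mk ((r.trans (γ i)).trans r.symm)) e = e
    rw [Path.Homotopic.Quotient.mk_trans, Path.Homotopic.Quotient.mk_trans,
      cov.monodromy_trans_apply, cov.monodromy_trans_apply, htriv, back]
  obtain ⟨e, rfl⟩ := (cov.monodromy_bijective (.mk q)).2 e
  apply (cov.monodromy_bijective (.mk q.symm)).1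
  have hmem : FundamentalGroup.fromPath (.mk ((q.trans δ).trans q.symm)) ∈
      (cov.monodromyPerm a).ker := hker ▸ Subgroup.mem_top _
  have h : cov.monodromy (.mk ((q.trans δ).trans q.symm)) e = e :=
    Equiv.congr_fun (MonoidHom.mem_ker.1 hmem) e
  rw [Path.Homotopic.Quotient.mk_trans, Path.Homotopic.Quotient.mk_trans,
    cov.monodromy_trans_apply, cov.monodromy_trans_apply] at h
  rw [h, back]

end Monodromy

namespace EdgeCocycle

variable {V : Type*} [DecidableEq V] [Fintype V] {K : AbstractSimplicialComplex V}
  {G : Type*} [Group G] [TopologicalSpace G] [DiscreteTopology G] (ψ : EdgeCocycle K G)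

theorem monodromy_edgePath {u v : V} (h : (skeleton K).Adj u v) (g : G) :
    ψ.isCoveringMap_proj.monodromy (.mk (edgePath K h)) (ψ.fiberPoint u g) =
      ψ.fiberPoint v (g * ψ.toFun u v) := by
  let Z := ψ.bundleCore
  have hsupp (t : I) (w : V) (hw : (edgePath K h t).1 w ≠ 0) : w = u ∨ w = v := by
    by_contra! hn
    refine hw ?_
    change (1 - (t : ℝ)) * Pi.single (M := fun _ => ℝ) u 1 w +
      t * Pi.single (M := fun _ => ℝ) v 1 w = 0
    rw [Pi.single_eq_of_ne hn.1, Pi.single_eq_of_ne hn.2, mul_zero, mul_zero, add_zero]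
  -- The lift of the edge, written in the charts that index the points of the edge. By the cocycle
  -- identity it has a constant second coordinate in the chart of `u`, and also in that of `v`.
  let sec : Realization K → Z.TotalSpace := fun x => ⟨x, g * ψ.toFun u (Z.indexAt x)⟩
  let Γ : I → Z.TotalSpace := fun t => sec (edgePath K h t)
  have hchart (t : I) (i : V) (hi : i = u ∨ i = v) :
      Z.localTriv i (Γ t) = (edgePath K h t, g * ψ.toFun u i) := by
    refine Prod.ext rfl ?_
    change g * ψ.toFun u _ * ψ.toFun _ i = _
    rw [mul_assoc, ψ.map_mul]
    refine (K.isRelLowerSet_faces h.2).2 ?_ (by simp)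
    have := hsupp t _ (Z.mem_baseSet_at _)
    intro w
    simp only [Finset.mem_insert, Finset.mem_singleton]
    rintro (rfl | rfl | rfl)
    exacts [.inl rfl, this, hi]
  refine monodromy_mk_eq_of_lift _ _ _ _ (Γ := Γ) ?_ rfl ?_ ?_
  · refine continuous_iff_continuousAt.2 fun t => ?_
    let i := Z.indexAt (edgePath K h t)
    have hi := hsupp t i (Z.mem_baseSet_at _)
    refine ((Z.localTriv i).toOpenPartialHomeomorph.continuousAt_iff_continuousAt_comp_left ?_).2 ?_
    · have hopen : IsOpen (edgePath K h ⁻¹' Z.baseSet i) :=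
        (Z.isOpen_baseSet i).preimage (edgePath K h).continuous
      exact hopen.mem_nhds (Z.mem_baseSet_at _)
    · have hcont : Continuous fun t => (edgePath K h t, g * ψ.toFun u i) := by fun_prop
      exact (hcont.congr fun t => (hchart t i hi).symm).continuousAt
  · have : sec (vertex K u) = ⟨vertex K u, g⟩ := by
      simp only [sec, Z, ψ.indexAt_vertex, ψ.map_self, mul_one]
    exact (congrArg sec (edgePath K h).source).trans this
  · have : sec (vertex K v) = ⟨vertex K v, g * ψ.toFun u v⟩ := by
      simp only [sec, Z, ψ.indexAt_vertex]
    exact (congrArg sec (edgePath K h).target).trans this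

theorem monodromy_walkPath {u v : V} (w : (skeleton K).Walk u v) (g : G) :
    ψ.isCoveringMap_proj.monodromy (.mk (walkPath K w)) (ψ.fiberPoint u g) =
      ψ.fiberPoint v (g * (w.darts.map fun e => ψ.toFun e.fst e.snd).prod) := by
  induction w generalizing g with
  | nil =>
    simp [walkPath, Path.Homotopic.Quotient.mk_refl, IsCoveringMap.monodromy_refl]
  | cons h w ih =>
    rw [walkPath, Path.Homotopic.Quotient.mk_trans, IsCoveringMap.monodromy_trans_apply,
      monodromy_edgePath, ih]
    simp [mul_assoc]

end EdgeCocycle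

/-! ### Path-connectedness of the realization -/

theorem joined_vertex {V : Type*} [DecidableEq V] [Fintype V] {K : AbstractSimplicialComplex V}
    (hconn : (skeleton K).Connected) (a : Realization K) (v : V) : Joined a (vertex K v) := by
  obtain ⟨u, hu⟩ := exists_apply_ne_zero a
  obtain ⟨w⟩ := hconn.preconnected u v
  refine Joined.trans ?_ ⟨walkPath K w⟩
  obtain ⟨s, hs, hsupp⟩ := a.2.2
  exact ⟨{
    toFun t := ⟨(1 - (t : ℝ)) • a.1 + (t : ℝ) • (Pi.single u 1 : V → ℝ),
      convex_stdSimplex ℝ V a.2.1 (single_mem_stdSimplex ℝ u)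
        (sub_nonneg.2 t.2.2) t.2.1 (by ring),
      s, hs, fun w hw => by
        by_contra hn
        have hwu : w ≠ u := fun h => hn (h ▸ hsupp u hu)
        have hw0 : a.1 w = 0 := by_contra fun h => hn (hsupp w h)
        exact hw (by simp [Pi.single_eq_of_ne hwu, hw0])⟩
    continuous_toFun := by fun_prop
    source' := by simp
    target' := by simp [vertex] }⟩

/-- A homomorphism that kills the reduced relators for a family of cycles that normally generates
the fundamental group kills the relators of all directed cycles. -/
theorem map_relator_eq_one {V : Type*} [DecidableEq V] [Fintype V]
    {K : AbstractSimplicialComplex V} (hconn : (skeleton K).Connected) {G : Type*} [Group G]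
    (f : FreeGroup (skeleton K).Dart →* G) {a : Realization K} {m : ℕ}
    {c : Fin m → DirectedCycle K}
    (hc : Subgroup.normalClosure (⋃ i, loopClass a (c i).loop) = ⊤)
    (hf : ∀ r ∈ reducedRelators K c, f r = 1) (d : DirectedCycle K) (n : ℤ) :
    f (d.relator n) = 1 := by
  -- The fibre of the covering is `G` with the discrete topology.
  let _ : TopologicalSpace G := ⊥
  have : DiscreteTopology G := ⟨rfl⟩
  have hshort : ∀ r ∈ shortRelators K, f r = 1 := fun r hr => hf r (.inl hr)
  let ψ := EdgeCocycle.ofHom f hshort n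
  have hloop (c : DirectedCycle K) (g : G) : ψ.isCoveringMap_proj.monodromy (.mk c.loop)
      (ψ.fiberPoint c.base g) = ψ.fiberPoint c.base (g * f (c.relator n)) := by
    rw [DirectedCycle.loop, ψ.monodromy_walkPath, EdgeCocycle.prod_darts_ofHom]
  obtain ⟨q⟩ := joined_vertex hconn a d.base
  have := monodromy_eq_of_normalClosure_loopClass_eq_top ψ.isCoveringMap_proj
    (fun i => (c i).loop) hc (fun i e => by
      obtain ⟨g, rfl⟩ := ψ.exists_eq_fiberPoint e
      rw [hloop, hf _ (.inr ⟨i, n, rfl⟩), mul_one]) q d.loop (ψ.fiberPoint d.base 1)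
  rw [hloop, one_mul] at this
  exact ψ.fiberPoint_injective _ this

end FlagPresentation

theorem proposition2 {V : Type*} [Fintype V] [DecidableEq V] (K : AbstractSimplicialComplex V)
    (hflag : FlagPresentation.IsFlag K) (hconn : (FlagPresentation.skeleton K).Connected) :
    -- (a) cycles of length 2
    (∀ c : FlagPresentation.DirectedCycle K, c.length = 2 →
      ∀ n : ℤ, c.relator n ∈ Subgroup.normalClosure {c.relator 1}) ∧
    -- (b) cycles of length 3
    (∀ c : FlagPresentation.DirectedCycle K, c.length = 3 →
      ∀ n : ℤ, c.relator n ∈ Subgroup.normalClosure {c.relator 1, c.relator (-1)}) ∧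
    -- (c) there are finitely many short relators, and together with the relators of cycles
    -- that normally generate the fundamental group they have all relators as consequences
    (FlagPresentation.shortRelators K).Finite ∧
    (∀ (a : FlagPresentation.Realization K) (m : ℕ) (c : Fin m → FlagPresentation.DirectedCycle K),
      Subgroup.normalClosure (⋃ i, FlagPresentation.loopClass a (c i).loop) = ⊤ →
        (∀ (d : FlagPresentation.DirectedCycle K) (n : ℤ),
          d.relator n ∈ Subgroup.normalClosure (FlagPresentation.reducedRelators K c)) ∧
        Subgroup.normalClosure (FlagPresentation.reducedRelators K c) =
          Subgroup.normalClosure (FlagPresentation.allRelators K)) := by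
  have mk_one (R : Set (FreeGroup (FlagPresentation.skeleton K).Dart)) :
      ∀ r ∈ R, QuotientGroup.mk' (Subgroup.normalClosure R) r = 1 := fun r hr =>
    (QuotientGroup.eq_one_iff r).2 (Subgroup.subset_normalClosure hr)
  refine ⟨fun c hc n => ?_, fun c hc n => ?_, FlagPresentation.finite_shortRelators K,
    fun a m c hc => ?_⟩
  · exact (QuotientGroup.eq_one_iff _).1
      (c.map_relator_eq_one_of_length_eq_two (QuotientGroup.mk' _) hc (mk_one {_} _ rfl) n)
  · exact (QuotientGroup.eq_one_iff _).1
      (c.map_relator_eq_one_of_length_eq_three (QuotientGroup.mk' _) hc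
        (mk_one {_, _} _ (.inl rfl)) (mk_one {_, _} _ (.inr rfl)) n)
  · have key (d : FlagPresentation.DirectedCycle K) (n : ℤ) :
        d.relator n ∈ Subgroup.normalClosure (FlagPresentation.reducedRelators K c) :=
      (QuotientGroup.eq_one_iff _).1
        (FlagPresentation.map_relator_eq_one hconn (QuotientGroup.mk' _) hc (mk_one _) d n)
    refine ⟨key, le_antisymm (Subgroup.normalClosure_le_normal ?_)
      (Subgroup.normalClosure_le_normal ?_)⟩
    · have hmem (d : FlagPresentation.DirectedCycle K) (n : ℤ) :
          d.relator n ∈ Subgroup.normalClosure (FlagPresentation.allRelators K) := by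
        rcases eq_or_ne n 0 with rfl | hn
        · simp [FlagPresentation.DirectedCycle.relator, one_mem]
        · exact Subgroup.subset_normalClosure ⟨d, n, hn, rfl⟩
      rintro r ((⟨d, -, rfl⟩ | ⟨d, -, rfl | rfl⟩) | ⟨i, n, rfl⟩) <;> exact hmem _ _
    · rintro r ⟨d, n, -, rfl⟩
      exact key d n
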